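/- Consider a stochastic game with a finite set $\mathcal N$ of agents, a finite set $\mathcal S$ of states, finite non-empty action sets $\mathcal A_j$ ($j\in\mathcal N$) with $\mathcal A=\prod_j\mathcal A_j$, transition function $T:\mathcal S\times\mathcal A\to\Delta(\mathcal S)$, rewards $R_j:\mathcal S\times\mathcal A\to\mathbb R$, and a discount factor $\gamma\in[0,1)$. A strategy of agent $j$ is a map $\pi_j:(\mathcal S\times\mathcal A)^*\times\mathcal S\to\Delta(\mathcal A_j)$ assigning to the complete history of past (state, joint action) pairs and the current state a distribution over actions; the agents randomize independently of each other. For a non-negative integer $K$, a $K$-memory strategy is a map $\bigl(\bigcup_{k=0}^K(\mathcal S\times\mathcal A)^k\bigr)\times\mathcal S\to\Delta(\mathcal A_j)$; it is played as the strategy that applies this map to the $\min\{K,t\}$ most recent steps of a history of length $t$ and the current state. The utility of agent $i$ under a strategy profile $\pi$ from the initial state $S$ is $u_i(S;\pi)=\mathbb E_\pi\bigl[\sum_{t=0}^\infty\gamma^t R_i(S_t,a_t)\,\big|\,S_0=S\bigr]$. A strategy $\pi_i$ is a best response to $\pi_{-i}$ if $u_i(S;\pi_i,\pi_{-i})\ge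 u_i(S;\pi_i',\pi_{-i})$ for every state $S\in\mathcal S$ and every strategy $\pi_i'$ of agent $i$ (of arbitrary, possibly infinite memory). Fix an agent $i$, and suppose that every other agent $j\ne i$ uses a $K_j$-memory strategy $\pi_j$, where the non-negative integers $K_j$ may differ. Then agent $i$ has a best response to $\pi_{-i}$ that is a $\bigl(\max_{j\ne i}K_j\bigr)$-memory strategy (the maximum being $0$ if there is no other agent). -/

import Mathlib

open MeasureTheory ProbabilityTheory

/-- A stochastic game with agents `N`, states `S` and action sets `A j`: a transition function
and an immediate reward function for every agent. -/
structure StochasticGame (N S : Type*) (A : N → Type*) where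
  /-- the distribution of the next state, given the state and the joint action -/
  T : S → (∀ j, A j) → PMF S
  /-- the immediate reward of an agent -/
  R : N → S → (∀ j, A j) → ℝ

namespace StochasticGame

/-- One step of play: a state together with the joint action taken in it. -/
def Step {N : Type*} (S : Type*) (A : N → Type*) : Type _ := S × (∀ j, A j)

instance {N S : Type*} {A : N → Type*} : MeasurableSpace (Step S A) := ⊤

instance {N S : Type*} {A : N → Type*} : DiscreteMeasurableSpace (Step S A) :=
  ⟨fun _ => trivial⟩

instance {N S : Type*} {A : N → Type*} [Finite N] [Finite S] [∀ j, Finite (A j)] :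
    Finite (Step S A) :=
  inferInstanceAs (Finite (S × (∀ j, A j)))

/-- The (infinite-memory, behavioral) strategies of agent `j`: maps from the complete history
(a finite sequence of steps, the oldest first) and the current state to a distribution over the
actions of `j`. -/
abbrev Strategy {N : Type*} (S : Type*) (A : N → Type*) (j : N) : Type _ :=
  List (Step S A) → S → PMF (A j)

/-- The `K`-memory strategies of agent `j`: maps from the histories of length at most `K` and the
current state to a distribution over the actions of `j`. -/
abbrev MemoryStrategy {N : Type*} (S : Type*) (A : N → Type*) (K : ℕ) (j : N) : Type _ :=
  {h : List (Step S A) // h.length ≤ K} → S → PMF (A j)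

/-- The most recent `min K (length h)` steps of a history `h`. -/
def recent {N S : Type*} {A : N → Type*} (K : ℕ) (h : List (Step S A)) :
    {h : List (Step S A) // h.length ≤ K} :=
  ⟨h.rtake K, by rw [List.rtake, List.length_drop]; omega⟩

/-- The inclusion of the `K`-memory strategies in the infinite-memory ones: only the most recent
`K` steps (or all of them, if there are fewer) are looked at. -/
def MemoryStrategy.toStrategy {N S : Type*} {A : N → Type*} {K : ℕ} {j : N}
    (σ : MemoryStrategy S A K j) : Strategy S A j :=
  fun h s => σ (recent K h) s

/-- The rewards of a finite game are bounded. -/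
theorem exists_reward_bound {N S : Type*} {A : N → Type*} [Finite N] [Finite S]
    [∀ j, Finite (A j)] (G : StochasticGame N S A) (i : N) :
    ∃ C : ℝ, ∀ y : Step S A, |G.R i y.1 y.2| ≤ C := by
  obtain ⟨C, hC⟩ := (Set.finite_range fun y : Step S A => |G.R i y.1 y.2|).bddAbove
  exact ⟨C, fun y => hC ⟨y, rfl⟩⟩

section Play

variable {N S : Type*} {A : N → Type*} [Fintype N] [DecidableEq N] [∀ j, Fintype (A j)]

/-- The product distribution on joint actions: the agents randomize independently. -/
noncomputable def jointAction (p : ∀ j, PMF (A j)) : PMF (∀ j, A j) :=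
  PMF.ofFintype (fun a => ∏ j, p j (a j)) (by
    rw [← Fintype.prod_sum]
    refine Finset.prod_eq_one fun j _ => ?_
    have h := (p j).tsum_coe
    rwa [tsum_fintype] at h)

/-- The distribution of the step made in state `s` after the history `h`, when the agents follow
the strategy profile `σ`. -/
noncomputable def stepAt (σ : ∀ j, Strategy S A j) (h : List (Step S A)) (s : S) :
    PMF (Step S A) :=
  (jointAction fun j => σ j h s).map fun a => (s, a)

/-- The list of the steps at times `0, …, n`. -/
def historyOf {n : ℕ} (x : (k : Finset.Iic n) → Step S A) : List (Step S A) :=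
  List.ofFn fun k : Fin (n + 1) => x ⟨k, Finset.mem_Iic.2 (Nat.le_of_lt_succ k.2)⟩

/-- The distribution of the step at time `n + 1` given the steps `x` at times `0, …, n`: the next
state is drawn by the transition function, and then the agents draw their actions. -/
noncomputable def nextStep (G : StochasticGame N S A) (σ : ∀ j, Strategy S A j) {n : ℕ}
    (x : (k : Finset.Iic n) → Step S A) : PMF (Step S A) :=
  (G.T (x ⟨n, Finset.mem_Iic.2 le_rfl⟩).1 (x ⟨n, Finset.mem_Iic.2 le_rfl⟩).2).bind fun s =>
    stepAt σ (historyOf x) s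

variable [Finite S]

/-- `nextStep` as a Markov kernel. -/
noncomputable def stepKernel (G : StochasticGame N S A) (σ : ∀ j, Strategy S A j) (n : ℕ) :
    Kernel ((k : Finset.Iic n) → Step S A) (Step S A) :=
  Kernel.ofFunOfCountable fun x => (G.nextStep σ x).toMeasure

instance (G : StochasticGame N S A) (σ : ∀ j, Strategy S A j) (n : ℕ) :
    IsMarkovKernel (G.stepKernel σ n) :=
  ⟨fun x => inferInstanceAs (IsProbabilityMeasure (G.nextStep σ x).toMeasure)⟩

/-- The law of the infinite play that starts in state `s` under the strategy profile `σ`. -/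
noncomputable def playMeasure (G : StochasticGame N S A) (σ : ∀ j, Strategy S A j) (s : S) :
    Measure (ℕ → Step S A) :=
  Kernel.trajMeasure (X := fun _ => Step S A) (stepAt σ [] s).toMeasure (G.stepKernel σ)

instance (G : StochasticGame N S A) (σ : ∀ j, Strategy S A j) (s : S) :
    IsProbabilityMeasure (G.playMeasure σ s) := by
  unfold playMeasure; infer_instance

/-- The discounted total reward `∑ₜ γ ^ t * R_{i,t}` of agent `i` along a play. -/
noncomputable def discountedReward (G : StochasticGame N S A) (γ : ℝ) (i : N)
    (x : ℕ → Step S A) : ℝ :=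
  ∑' t : ℕ, γ ^ t * G.R i (x t).1 (x t).2

/-- The utility of agent `i`: the expected discounted total reward from the initial state `s`. -/
noncomputable def utility (G : StochasticGame N S A) (γ : ℝ) (i : N) (s : S)
    (σ : ∀ j, Strategy S A j) : ℝ :=
  ∫ x, G.discountedReward γ i x ∂(G.playMeasure σ s)

/-- The profile in which agent `i` plays `σi` and the other agents play `τ`. -/
def profile {i : N} (σi : Strategy S A i) (τ : ∀ j : {j : N // j ≠ i}, Strategy S A j) :
    ∀ j, Strategy S A j :=
  (Equiv.piSplitAt i fun j => Strategy S A j).symm (σi, τ)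

/-- `σi` is a best response of agent `i` to the strategies `τ` of the other agents: from every
initial state it does at least as well as every other infinite-memory strategy. -/
def IsBestResponse (G : StochasticGame N S A) (γ : ℝ) {i : N} (σi : Strategy S A i)
    (τ : ∀ j : {j : N // j ≠ i}, Strategy S A j) : Prop :=
  ∀ (s : S) (σi' : Strategy S A i),
    G.utility γ i s (profile σi τ) ≥ G.utility γ i s (profile σi' τ)

/-! For a discount factor in `[0, 1)` the series and the expectation in `utility` converge. -/

theorem summable_discounted (G : StochasticGame N S A) {γ : ℝ} (h0 : 0 ≤ γ) (h1 : γ < 1) (i : N)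
    (x : ℕ → Step S A) : Summable fun t : ℕ => γ ^ t * G.R i (x t).1 (x t).2 := by
  obtain ⟨C, hC⟩ := G.exists_reward_bound i
  refine Summable.of_norm_bounded ((summable_geometric_of_lt_one h0 h1).mul_right C) fun t => ?_
  rw [Real.norm_eq_abs, abs_mul, abs_of_nonneg (pow_nonneg h0 t)]
  exact mul_le_mul_of_nonneg_left (hC (x t)) (pow_nonneg h0 t)

theorem integrable_discountedReward (G : StochasticGame N S A) {γ : ℝ} (h0 : 0 ≤ γ) (h1 : γ < 1)
    (i : N) (s : S) (σ : ∀ j, Strategy S A j) :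
    Integrable (G.discountedReward γ i) (G.playMeasure σ s) := by
  obtain ⟨C, hC⟩ := G.exists_reward_bound i
  have hmeas : Measurable (G.discountedReward γ i) := by
    refine measurable_of_tendsto_metrizable
      (f := fun (n : ℕ) x => ∑ t ∈ Finset.range n, γ ^ t * G.R i (x t).1 (x t).2) (fun n => ?_)
      (tendsto_pi_nhds.2 fun x => (G.summable_discounted h0 h1 i x).hasSum.tendsto_sum_nat)
    refine Finset.measurable_fun_sum _ fun t _ => Measurable.const_mul ?_ _
    exact (Measurable.of_discrete (f := fun y : Step S A => G.R i y.1 y.2)).comp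
      (measurable_pi_apply t)
  refine Integrable.of_bound hmeas.aestronglyMeasurable (∑' t : ℕ, γ ^ t * C)
    (Filter.Eventually.of_forall fun x => ?_)
  refine tsum_of_norm_bounded ((summable_geometric_of_lt_one h0 h1).mul_right C).hasSum fun t => ?_
  rw [Real.norm_eq_abs, abs_mul, abs_of_nonneg (pow_nonneg h0 t)]
  exact mul_le_mul_of_nonneg_left (hC (x t)) (pow_nonneg h0 t)

end Play

end StochasticGame

/-! Once the strategies of the others are fixed, agent i faces a Markov decision process. Let K be
the largest of their memories. The last K steps (all steps, if there are fewer) together with the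
current state form a finite Markov state: they determine the others' action distributions, and the
window after one more step is determined by the window before it and that step (`recent_concat`).

The Bellman optimality operator on functions of (window, state) is a γ-contraction, so it has a
fixed point V with a maximizing action at each point (`exists_bellman_solution`). Read as a function
of full histories, V satisfies the Bellman inequality for every strategy of agent i, of any memory,
and equality for the strategy that plays the maximizer. Telescoping along the law of the play turns
these into an upper bound for all utilities (`utility_le`) and a lower bound for that strategy
(`le_utility`), both equal to V at the empty history. The best response found is thus deterministic
and does not depend on the initial state. -/

/-! ### Expectations under distributions on finite sets -/

/-- The expectation of a real function under a probability mass function. -/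
noncomputable def PMF.expect {α : Type*} (p : PMF α) (g : α → ℝ) : ℝ :=
  ∑' a, (p a).toReal * g a

namespace PMF

variable {α β : Type*}

theorem expect_eq_sum [Fintype α] (p : PMF α) (g : α → ℝ) :
    p.expect g = ∑ a, (p a).toReal * g a :=
  tsum_fintype _

theorem expect_eq_integral [Finite α] [MeasurableSpace α] [MeasurableSingletonClass α]
    (p : PMF α) (g : α → ℝ) : p.expect g = ∫ a, g a ∂p.toMeasure := by
  cases nonempty_fintype α
  simp [expect_eq_sum, PMF.integral_eq_sum]

theorem sum_toReal [Fintype α] (p : PMF α) : ∑ a, (p a).toReal = 1 := by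
  rw [← ENNReal.toReal_sum fun a _ => p.apply_ne_top a, ← tsum_fintype (L := .unconditional _),
    p.tsum_coe, ENNReal.toReal_one]

theorem expect_const [Finite α] (p : PMF α) (c : ℝ) : (p.expect fun _ => c) = c := by
  cases nonempty_fintype α
  rw [expect_eq_sum, ← Finset.sum_mul, p.sum_toReal, one_mul]

theorem expect_mono [Finite α] (p : PMF α) {f g : α → ℝ} (h : ∀ a, f a ≤ g a) :
    p.expect f ≤ p.expect g := by
  cases nonempty_fintype α
  simp only [expect_eq_sum]
  exact Finset.sum_le_sum fun a _ => mul_le_mul_of_nonneg_left (h a) ENNReal.toReal_nonneg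

theorem expect_add_const [Finite α] (p : PMF α) (g : α → ℝ) (c : ℝ) :
    (p.expect fun a => g a + c) = p.expect g + c := by
  cases nonempty_fintype α
  simp only [expect_eq_sum, mul_add, Finset.sum_add_distrib]
  rw [← Finset.sum_mul, p.sum_toReal, one_mul]

theorem expect_pure (a : α) (g : α → ℝ) : (PMF.pure a).expect g = g a := by
  rw [expect, tsum_eq_single a]
  · simp
  · intro b hb
    simp [PMF.pure_apply, hb]

theorem expect_bind [Finite α] [Finite β] (p : PMF α) (q : α → PMF β) (g : β → ℝ) :
    (p.bind q).expect g = p.expect fun a => (q a).expect g := by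
  cases nonempty_fintype α
  cases nonempty_fintype β
  simp only [expect_eq_sum, PMF.bind_apply, tsum_fintype, Finset.mul_sum]
  rw [Finset.sum_comm]
  refine Finset.sum_congr rfl fun b _ => ?_
  rw [ENNReal.toReal_sum fun a _ => ENNReal.mul_ne_top (p.apply_ne_top a) ((q a).apply_ne_top b),
    Finset.sum_mul]
  exact Finset.sum_congr rfl fun a _ => by rw [ENNReal.toReal_mul, mul_assoc]

theorem expect_map [Finite α] [Finite β] (p : PMF α) (f : α → β) (g : β → ℝ) :
    (p.map f).expect g = p.expect fun a => g (f a) := by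
  rw [← PMF.bind_pure_comp, expect_bind]
  simp only [Function.comp_apply, expect_pure]

end PMF

/-! ### One-step recursion for expectations along a play -/

/-- The law of the first coordinate of a trajectory is the initial distribution. -/
theorem ProbabilityTheory.Kernel.map_eval_zero_trajMeasure {X : ℕ → Type*}
    [∀ n, MeasurableSpace (X n)] (μ₀ : Measure (X 0)) [IsProbabilityMeasure μ₀]
    (κ : (n : ℕ) → Kernel ((i : Finset.Iic n) → X i) (X (n + 1))) [∀ n, IsMarkovKernel (κ n)] :
    (Kernel.trajMeasure μ₀ κ).map (fun x => x 0) = μ₀ := by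
  have hm : Measurable (Preorder.frestrictLe (π := X) 0) := by fun_prop
  have he : Measurable fun y : (i : Finset.Iic 0) → X i => y ⟨0, Finset.mem_Iic.2 le_rfl⟩ :=
    measurable_pi_apply _
  have hc := Measure.map_map (μ := Kernel.trajMeasure μ₀ κ) he hm
  refine hc.symm.trans ?_
  rw [Kernel.trajMeasure, Measure.map_comp _ _ hm, Kernel.traj_map_frestrictLe,
    Kernel.partialTraj_self, Measure.id_comp]
  have hs := (MeasurableEquiv.piUnique fun i : Finset.Iic 0 => X i).symm.measurable
  exact (Measure.map_map (μ := μ₀) he hs).trans Measure.map_id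

namespace StochasticGame

variable {N S : Type*} {A : N → Type*}

/-- The list of the first `t` steps of a play. -/
def prefixOf (t : ℕ) (x : ℕ → Step S A) : List (Step S A) :=
  List.ofFn fun k : Fin t => x k

theorem prefixOf_succ (t : ℕ) (x : ℕ → Step S A) :
    prefixOf (t + 1) x = prefixOf t x ++ [x t] := by
  simp only [prefixOf, List.ofFn_succ', List.concat_eq_append, Fin.val_last, Fin.val_castSucc]

/-- The value of making the step `y` after the history `l` if the value of being in a state after
a history is given by `W`. -/
noncomputable def stepValue (G : StochasticGame N S A) (γ : ℝ) (i : N)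
    (W : List (Step S A) → S → ℝ) (l : List (Step S A)) (y : Step S A) : ℝ :=
  G.R i y.1 y.2 + γ * (G.T y.1 y.2).expect (W (l ++ [y]))

section Play

variable [Fintype N] [∀ j, Fintype (A j)]

theorem expect_stepAt [DecidableEq N] [Finite S] (σ : ∀ j, Strategy S A j) (h : List (Step S A)) (s : S)
    (g : Step S A → ℝ) :
    (stepAt σ h s).expect g = (jointAction fun j => σ j h s).expect fun a => g (s, a) :=
  PMF.expect_map _ (fun a => ((s, a) : Step S A)) g

variable [Finite S]

/-- The integrand factors through the first t + 1 steps, which range over a finite set. -/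
theorem integrable_prefix (μ : Measure (ℕ → Step S A)) [IsFiniteMeasure μ]
    (ψ : List (Step S A) → Step S A → ℝ) (t : ℕ) :
    Integrable (fun x => ψ (prefixOf t x) (x t)) μ := by
  let g : ((k : Finset.Iic t) → Step S A) → ℝ := fun y =>
    ψ (List.ofFn fun k : Fin t => y ⟨k, Finset.mem_Iic.2 k.2.le⟩) (y ⟨t, Finset.mem_Iic.2 le_rfl⟩)
  have hg : Integrable g (μ.map (Preorder.frestrictLe (π := fun _ => Step S A) t)) :=
    .of_finite
  exact hg.comp_measurable (by fun_prop)

variable [DecidableEq N] (G : StochasticGame N S A) (σ : ∀ j, Strategy S A j) (s : S)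

theorem integral_prefix_zero (ψ : List (Step S A) → Step S A → ℝ) :
    ∫ x, ψ (prefixOf 0 x) (x 0) ∂G.playMeasure σ s = (stepAt σ [] s).expect (ψ []) := by
  rw [PMF.expect_eq_integral]
  conv_rhs => rw [← Kernel.map_eval_zero_trajMeasure (X := fun _ => Step S A)
    (stepAt σ [] s).toMeasure (G.stepKernel σ)]
  rw [integral_map (measurable_pi_apply 0).aemeasurable Measurable.of_discrete.aestronglyMeasurable]
  rfl

/-- By construction of the trajectory measure, the joint law of the steps up to time n and the next
step is the composition product of the former's law with `stepKernel`; Fubini then integrates out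
the last step. -/
theorem integral_prefix_succ (ψ : List (Step S A) → Step S A → ℝ) (n : ℕ) :
    ∫ x, ψ (prefixOf (n + 1) x) (x (n + 1)) ∂G.playMeasure σ s =
      ∫ x, ((G.T (x n).1 (x n).2).expect fun s' =>
        (stepAt σ (prefixOf (n + 1) x) s').expect (ψ (prefixOf (n + 1) x))) ∂G.playMeasure σ s := by
  have key := Kernel.map_frestrictLe_trajMeasure_compProd_eq_map_trajMeasure
    (X := fun _ => Step S A) (μ₀ := (stepAt σ [] s).toMeasure) (κ := G.stepKernel σ) (a := n)
  let g : (((k : Finset.Iic n) → Step S A) × Step S A) → ℝ := fun z => ψ (historyOf z.1) z.2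
  have h1 : ∫ x, ψ (prefixOf (n + 1) x) (x (n + 1)) ∂G.playMeasure σ s =
      ∫ z, g z ∂((G.playMeasure σ s).map fun x =>
        (Preorder.frestrictLe (π := fun _ => Step S A) n x, x (n + 1))) := by
    rw [integral_map (by fun_prop) (Measurable.of_discrete.aestronglyMeasurable)]
    rfl
  have : IsProbabilityMeasure ((G.playMeasure σ s).map
      (Preorder.frestrictLe (π := fun _ => Step S A) n)) :=
    Measure.isProbabilityMeasure_map (by fun_prop)
  rw [h1, playMeasure, ← key, ← playMeasure, Measure.integral_compProd .of_finite,
    integral_map (by fun_prop) (Measurable.of_discrete.aestronglyMeasurable)]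
  refine integral_congr_ae (.of_forall fun x => ?_)
  change ∫ y, ψ (prefixOf (n + 1) x) y ∂(G.nextStep σ _).toMeasure = _
  rw [← PMF.expect_eq_integral, nextStep, PMF.expect_bind]
  rfl

/-- The comparison is only needed after averaging over the step drawn at a given history and state.
This matters because the Bellman equality for a strategy holds on average over the joint action, not
for each action. -/
theorem integral_prefix_mono {ψ φ : List (Step S A) → Step S A → ℝ}
    (h : ∀ l s, (stepAt σ l s).expect (ψ l) ≤ (stepAt σ l s).expect (φ l)) (t : ℕ) :
    ∫ x, ψ (prefixOf t x) (x t) ∂G.playMeasure σ s ≤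
      ∫ x, φ (prefixOf t x) (x t) ∂G.playMeasure σ s := by
  cases t with
  | zero => simpa only [integral_prefix_zero] using h [] s
  | succ n =>
    simp only [integral_prefix_succ]
    refine integral_mono ?_ ?_ fun x => PMF.expect_mono _ fun s' => h _ s'
    · simpa only [prefixOf_succ] using integrable_prefix _ (fun l y =>
        (G.T y.1 y.2).expect fun s' => (stepAt σ (l ++ [y]) s').expect (ψ (l ++ [y]))) n
    · simpa only [prefixOf_succ] using integrable_prefix _ (fun l y =>
        (G.T y.1 y.2).expect fun s' => (stepAt σ (l ++ [y]) s').expect (φ (l ++ [y]))) n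

theorem expect_stepAt_fst (l : List (Step S A)) (f : S → ℝ) :
    (stepAt σ l s).expect (fun y => f y.1) = f s := by
  rw [expect_stepAt]
  cases nonempty_fintype S
  exact PMF.expect_const (jointAction fun j => σ j l s) (f s)

/-- This converts the Bellman inequality at each history into the scalar inequality between
consecutive times that `tsum_discounted_le` telescopes. -/
theorem integral_stepValue (γ : ℝ) (i : N) (W : List (Step S A) → S → ℝ) (t : ℕ) :
    ∫ x, G.stepValue γ i W (prefixOf t x) (x t) ∂G.playMeasure σ s =
      ∫ x, G.R i (x t).1 (x t).2 ∂G.playMeasure σ s +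
        γ * ∫ x, W (prefixOf (t + 1) x) (x (t + 1)).1 ∂G.playMeasure σ s := by
  rw [G.integral_prefix_succ σ s (fun l y => W l y.1) t, ← integral_const_mul, ← integral_add]
  · simp only [expect_stepAt_fst, prefixOf_succ, stepValue]
  · exact integrable_prefix _ (fun _ y => G.R i y.1 y.2) t
  · refine Integrable.const_mul ?_ γ
    simpa only [prefixOf_succ] using integrable_prefix _ (fun l y =>
        (G.T y.1 y.2).expect fun s' =>
          (stepAt σ (l ++ [y]) s').expect fun z => W (l ++ [y]) z.1) t

end Play

end StochasticGame

/-! ### Discounted telescoping and the Bellman fixed point -/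

/-- Telescoping: a bounded sequence that dominates its one-step discounted lookahead dominates the
discounted sum. -/
theorem tsum_discounted_le {γ : ℝ} (h0 : 0 ≤ γ) (h1 : γ < 1) {r v : ℕ → ℝ} {C : ℝ}
    (hv : ∀ t, |v t| ≤ C) (hr : Summable fun t => γ ^ t * r t)
    (h : ∀ t, r t + γ * v (t + 1) ≤ v t) : ∑' t, γ ^ t * r t ≤ v 0 := by
  -- The first n rewards plus the discounted value still to come never exceed the initial value; the
  -- second term vanishes in the limit because v is bounded.
  have hsum : ∀ n, ∑ t ∈ Finset.range n, γ ^ t * r t + γ ^ n * v n ≤ v 0 := by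
    intro n
    induction n with
    | zero => simp
    | succ n ih =>
      rw [Finset.sum_range_succ]
      have := mul_le_mul_of_nonneg_left (h n) (pow_nonneg h0 n)
      rw [pow_succ]
      linarith
  have hz : Filter.Tendsto (fun n => γ ^ n * v n) Filter.atTop (nhds 0) := by
    refine squeeze_zero_norm (a := fun n => γ ^ n * C) (fun n => ?_) ?_
    · rw [Real.norm_eq_abs, abs_mul, abs_of_nonneg (pow_nonneg h0 n)]
      exact mul_le_mul_of_nonneg_left (hv n) (pow_nonneg h0 n)
    · simpa using (tendsto_pow_atTop_nhds_zero_of_lt_one h0 h1).mul_const C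
  have := hr.hasSum.tendsto_sum_nat.add hz
  rw [add_zero] at this
  exact le_of_tendsto' this hsum

/-- The Bellman equation: a `γ`-contracting family of action values on a finite state space has a
fixed point together with an optimal choice of actions. -/
theorem exists_bellman_solution {X B : Type*} [Finite X] [Finite B] [Nonempty B] {γ : ℝ}
    (h0 : 0 ≤ γ) (h1 : γ < 1) (Q : (X → ℝ) → X → B → ℝ)
    (hQ : ∀ V V' d, (∀ x, V x ≤ V' x + d) → ∀ x b, Q V x b ≤ Q V' x b + γ * d) :
    ∃ (V : X → ℝ) (f : X → B), (∀ x b, Q V x b ≤ V x) ∧ ∀ x, Q V x (f x) = V x := by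
  cases nonempty_fintype X
  have hmax : ∀ (V : X → ℝ) (x : X), ∃ b, ∀ b', Q V x b' ≤ Q V x b := fun V x =>
    Finite.exists_max _
  choose f hf using hmax
  -- Take d to be the sup distance in `hQ`, then replace the maximizer for V by the one for V'.
  have hle : ∀ V V' x, Q V x (f V x) ≤ Q V' x (f V' x) + γ * dist V V' := fun V V' x => by
    refine (hQ V V' (dist V V') (fun z => ?_) x _).trans (by gcongr; exact hf V' x _)
    have := (abs_le.1 ((Real.dist_eq _ _).symm.trans_le (dist_le_pi_dist V V' z))).2
    linarith
  have hc : ContractingWith ⟨γ, h0⟩ fun (V : X → ℝ) x => Q V x (f V x) := by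
    refine ⟨h1, LipschitzWith.of_dist_le_mul fun V V' => ?_⟩
    refine (dist_pi_le_iff (mul_nonneg h0 dist_nonneg)).2 fun x => ?_
    rw [Real.dist_eq, abs_sub_le_iff]
    have h2 := hle V V' x
    have h3 := hle V' V x
    rw [dist_comm V' V] at h3
    exact ⟨sub_le_iff_le_add'.2 h2, sub_le_iff_le_add'.2 h3⟩
  have hfix : ∀ x, Q (hc.fixedPoint _) x (f (hc.fixedPoint _) x) = hc.fixedPoint _ x :=
    congrFun hc.fixedPoint_isFixedPt
  exact ⟨hc.fixedPoint _, f (hc.fixedPoint _), fun x b => (hf _ x b).trans_eq (hfix x), hfix⟩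

/-! ### The memory window as a Markov state, and responses to fixed opponents -/

namespace StochasticGame

variable {N S : Type*} {A : N → Type*}

theorem recent_recent {k K : ℕ} (hk : k ≤ K) (h : List (Step S A)) :
    recent k (recent K h).1 = recent k h := by
  apply Subtype.ext
  simp only [recent, List.rtake, List.length_drop, List.drop_drop]
  congr 1
  omega

/-- Appending a step pushes out whatever lies beyond the last K steps, so older history cannot
influence the next window. -/
theorem recent_concat (K : ℕ) (h : List (Step S A)) (y : Step S A) :
    recent K ((recent K h).1 ++ [y]) = recent K (h ++ [y]) := by
  apply Subtype.ext
  cases K with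
  | zero => simp [recent]
  | succ K =>
    have := congrArg Subtype.val (recent_recent K.le_succ h)
    simp only [recent] at this
    simp only [recent, List.rtake_concat_succ, this]

theorem stepValue_le_add [Finite S] (G : StochasticGame N S A) {γ : ℝ} (h0 : 0 ≤ γ) (i : N)
    {W W' : List (Step S A) → S → ℝ} {d : ℝ} (h : ∀ l s, W l s ≤ W' l s + d)
    (l : List (Step S A)) (y : Step S A) :
    G.stepValue γ i W l y ≤ G.stepValue γ i W' l y + γ * d := by
  have := mul_le_mul_of_nonneg_left
    (((G.T y.1 y.2).expect_mono (h (l ++ [y]))).trans_eq (PMF.expect_add_const _ _ d)) h0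
  simp only [stepValue]
  linarith

theorem stepValue_recent (G : StochasticGame N S A) (γ : ℝ) (i : N) {K : ℕ}
    (V : {h : List (Step S A) // h.length ≤ K} × S → ℝ) (l : List (Step S A)) (y : Step S A) :
    G.stepValue γ i (fun l s => V (recent K l, s)) (recent K l).1 y =
      G.stepValue γ i (fun l s => V (recent K l, s)) l y := by
  simp only [stepValue, recent_concat]

section Profile

variable [DecidableEq N] {i : N}

theorem profile_self (σi : Strategy S A i) (τ : ∀ j : {j : N // j ≠ i}, Strategy S A j) :
    profile σi τ i = σi := by
  simp [profile, Equiv.piSplitAt]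

theorem profile_of_ne (σi : Strategy S A i) (τ : ∀ j : {j : N // j ≠ i}, Strategy S A j) {j : N}
    (hj : j ≠ i) : profile σi τ j = τ ⟨j, hj⟩ := by
  simp [profile, Equiv.piSplitAt, hj]

/-- The distribution of the joint action after the history `h` in state `s` when agent `i` plays
the action `b` and the others follow `τ`. -/
noncomputable def jointResponse [Fintype N] [∀ j, Fintype (A j)]
    (τ : ∀ j : {j : N // j ≠ i}, Strategy S A j) (h : List (Step S A)) (s : S) (b : A i) :
    PMF (∀ j, A j) :=
  jointAction fun j => profile (fun _ _ => PMF.pure b) τ j h s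

/-- The product distribution is linear in the factor of agent i, so a mixed action is a mixture of
pure ones against the same opponents. -/
theorem jointAction_profile [Fintype N] [∀ j, Fintype (A j)] (σi : Strategy S A i)
    (τ : ∀ j : {j : N // j ≠ i}, Strategy S A j) (h : List (Step S A)) (s : S) :
    (jointAction fun j => profile σi τ j h s) = (σi h s).bind (jointResponse τ h s) := by
  ext a
  have hprod : ∀ σi : Strategy S A i, (jointAction fun j => profile σi τ j h s) a =
      σi h s (a i) * ∏ j : {j // j ≠ i}, τ j h s (a j) := fun σi => by
    simp only [jointAction, PMF.ofFintype_apply]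
    rw [Fintype.prod_eq_mul_prod_subtype_ne _ i, profile_self]
    exact congrArg _ (Finset.prod_congr rfl fun j _ => by rw [profile_of_ne _ _ j.2])
  -- Only the pure action b = a i gives the joint action a positive weight in the mixture.
  rw [PMF.bind_apply, tsum_eq_single (a i), jointResponse, hprod, hprod]
  · simp
  · intro b hb
    rw [jointResponse, hprod]
    simp [PMF.pure_apply, hb.symm]

theorem expect_stepAt_profile [Fintype N] [∀ j, Fintype (A j)] [Finite S] (σi : Strategy S A i)
    (τ : ∀ j : {j : N // j ≠ i}, Strategy S A j) (h : List (Step S A)) (s : S)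
    (g : Step S A → ℝ) :
    (stepAt (profile σi τ) h s).expect g =
      (σi h s).expect fun b => (jointResponse τ h s b).expect fun a => g (s, a) := by
  rw [expect_stepAt, jointAction_profile, PMF.expect_bind]

end Profile

/-! ### Utility bounds from Bellman inequalities, and the best response -/

section Play

variable [Fintype N] [DecidableEq N] [∀ j, Fintype (A j)] [Finite S]

/-- The sum and the expectation may be exchanged because the rewards are bounded, which gives a
geometric majorant. -/
theorem hasSum_utility (G : StochasticGame N S A) {γ : ℝ} (h0 : 0 ≤ γ) (h1 : γ < 1) (i : N)
    (s : S) (σ : ∀ j, Strategy S A j) :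
    HasSum (fun t => γ ^ t * ∫ x, G.R i (x t).1 (x t).2 ∂G.playMeasure σ s)
      (G.utility γ i s σ) := by
  obtain ⟨C, hC⟩ := G.exists_reward_bound i
  have hint : ∀ t, Integrable (fun x => γ ^ t * G.R i (x t).1 (x t).2) (G.playMeasure σ s) :=
    fun t => (integrable_prefix _ (fun _ y => G.R i y.1 y.2) t).const_mul _
  have hsum : Summable fun t => ∫ x, ‖γ ^ t * G.R i (x t).1 (x t).2‖ ∂G.playMeasure σ s := by
    refine .of_nonneg_of_le (fun t => integral_nonneg fun x => norm_nonneg _) (fun t => ?_)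
      ((summable_geometric_of_lt_one h0 h1).mul_right C)
    refine (integral_mono (hint t).norm (integrable_const (γ ^ t * C)) fun x => ?_).trans_eq
      (by simp)
    dsimp only
    rw [Real.norm_eq_abs, abs_mul, abs_of_nonneg (pow_nonneg h0 t)]
    exact mul_le_mul_of_nonneg_left (hC (x t)) (pow_nonneg h0 t)
  have h := hasSum_integral_of_summable_integral_norm hint hsum
  simp only [integral_const_mul] at h
  exact h

theorem abs_integral_prefix_le (G : StochasticGame N S A) (σ : ∀ j, Strategy S A j) (s : S)
    {W : List (Step S A) → S → ℝ} {C : ℝ} (hC : ∀ l s, |W l s| ≤ C) (t : ℕ) :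
    |∫ x, W (prefixOf t x) (x t).1 ∂G.playMeasure σ s| ≤ C := by
  have := norm_integral_le_of_norm_le_const (μ := G.playMeasure σ s)
    (f := fun x => W (prefixOf t x) (x t).1) (.of_forall fun x => hC _ _)
  simpa using this

theorem integral_prefix_fst_zero (G : StochasticGame N S A) (σ : ∀ j, Strategy S A j) (s : S)
    (W : List (Step S A) → S → ℝ) :
    ∫ x, W (prefixOf 0 x) (x 0).1 ∂G.playMeasure σ s = W [] s := by
  rw [G.integral_prefix_zero σ s fun l y => W l y.1, expect_stepAt_fst]

/-- A bounded supersolution of the evaluation equation bounds the utility from above. -/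
theorem utility_le (G : StochasticGame N S A) {γ : ℝ} (h0 : 0 ≤ γ) (h1 : γ < 1) (i : N) (s : S)
    (σ : ∀ j, Strategy S A j) {W : List (Step S A) → S → ℝ} {C : ℝ} (hC : ∀ l s, |W l s| ≤ C)
    (hW : ∀ l s, (stepAt σ l s).expect (G.stepValue γ i W l) ≤ W l s) :
    G.utility γ i s σ ≤ W [] s := by
  have hu := G.hasSum_utility h0 h1 i s σ
  rw [← hu.tsum_eq, ← G.integral_prefix_fst_zero σ s W]
  refine tsum_discounted_le h0 h1 (v := fun t => ∫ x, W (prefixOf t x) (x t).1 ∂G.playMeasure σ s)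
    (G.abs_integral_prefix_le σ s hC) hu.summable fun t => ?_
  rw [← integral_stepValue]
  refine G.integral_prefix_mono σ s (φ := fun l y => W l y.1) (fun l s => ?_) t
  rw [expect_stepAt_fst]
  exact hW l s

/-- A bounded subsolution of the evaluation equation bounds the utility from below. -/
theorem le_utility (G : StochasticGame N S A) {γ : ℝ} (h0 : 0 ≤ γ) (h1 : γ < 1) (i : N) (s : S)
    (σ : ∀ j, Strategy S A j) {W : List (Step S A) → S → ℝ} {C : ℝ} (hC : ∀ l s, |W l s| ≤ C)
    (hW : ∀ l s, W l s ≤ (stepAt σ l s).expect (G.stepValue γ i W l)) :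
    W [] s ≤ G.utility γ i s σ := by
  have hu := (G.hasSum_utility h0 h1 i s σ).neg
  -- The telescoping bound is applied to the negated rewards and values.
  simp only [← mul_neg] at hu
  rw [← neg_le_neg_iff, ← hu.tsum_eq, ← G.integral_prefix_fst_zero σ s W]
  refine tsum_discounted_le h0 h1
    (v := fun t => -∫ x, W (prefixOf t x) (x t).1 ∂G.playMeasure σ s)
    (fun t => (abs_neg _).trans_le (G.abs_integral_prefix_le σ s hC t)) hu.summable fun t => ?_
  rw [mul_neg, ← neg_add, neg_le_neg_iff, ← integral_stepValue]
  refine G.integral_prefix_mono σ s (ψ := fun l y => W l y.1) (fun l s => ?_) t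
  rw [expect_stepAt_fst]
  exact hW l s

/-- If the other agents only look at the `K` most recent steps, there is a `K`-memory best
response. -/
theorem exists_memory_bestResponse (G : StochasticGame N S A) {γ : ℝ} (h0 : 0 ≤ γ) (h1 : γ < 1)
    {i : N} [Nonempty (A i)] (K : ℕ) (τ : ∀ j : {j : N // j ≠ i}, Strategy S A j)
    (hτ : ∀ j h, τ j (recent K h).1 = τ j h) :
    ∃ σ : MemoryStrategy S A K i, G.IsBestResponse γ σ.toStrategy τ := by
  have : Finite {h : List (Step S A) // h.length ≤ K} := (List.finite_length_le _ K).to_subtype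
  -- The decision process lives on pairs (window, state). Windows shorter than K are included, so
  -- the start of a play needs no special treatment.
  obtain ⟨V, f, hV, hf⟩ := exists_bellman_solution (X := {h : List (Step S A) // h.length ≤ K} × S)
    (B := A i) h0 h1 (fun V x b => (jointResponse τ x.1.1 x.2 b).expect fun a =>
      G.stepValue γ i (fun l s => V (recent K l, s)) x.1.1 (x.2, a)) (by
    intro V V' d hd x b
    rw [← PMF.expect_add_const]
    exact PMF.expect_mono _ fun a => G.stepValue_le_add h0 i (fun l s => hd (recent K l, s)) _ _)
  obtain ⟨C, hC⟩ := (Set.finite_range fun x => |V x|).bddAbove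
  have hbound : ∀ l s, |V (recent K l, s)| ≤ C := fun l s => hC ⟨_, rfl⟩
  have hjoint : ∀ h s b, jointResponse τ (recent K h).1 s b = jointResponse τ h s b := by
    intro h s b
    unfold jointResponse
    congr 1
    funext j
    by_cases hj : j = i
    · subst hj
      simp only [profile_self]
    · simp only [profile_of_ne _ _ hj, hτ]
  -- Action values agree at a history and at its window, so the Bellman relations for V lift to all
  -- histories.
  have hQ : ∀ h s b, ((jointResponse τ (recent K h).1 s b).expect fun a =>
      G.stepValue γ i (fun l s => V (recent K l, s)) (recent K h).1 (s, a)) =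
        (jointResponse τ h s b).expect fun a =>
          G.stepValue γ i (fun l s => V (recent K l, s)) h (s, a) := fun h s b => by
    rw [hjoint]
    exact congrArg _ (funext fun a => G.stepValue_recent γ i V h (s, a))
  refine ⟨fun m s => PMF.pure (f (m, s)), fun s σi' => ?_⟩
  -- Both bounds use the same function of histories: it is a supersolution under an arbitrary σi'
  -- and a subsolution under the maximizing strategy, so its value at the empty history separates
  -- the two utilities.
  refine (G.utility_le h0 h1 i s _ hbound fun l s => ?_).trans
    (G.le_utility h0 h1 i s _ hbound fun l s => ?_)
  · rw [expect_stepAt_profile]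
    exact ((σi' l s).expect_mono fun b => (hQ l s b).symm.trans_le
      (hV (recent K l, s) b)).trans_eq ((σi' l s).expect_const _)
  · rw [expect_stepAt_profile, MemoryStrategy.toStrategy, PMF.expect_pure]
    exact ((hQ l s _).symm.trans (hf (recent K l, s))).ge

end Play

end StochasticGame

theorem mainTheorem3 {N S : Type*} {A : N → Type*} [Fintype N] [DecidableEq N] [Finite S]
    [∀ j, Fintype (A j)] (G : StochasticGame N S A) (γ : ℝ) (hγ0 : 0 ≤ γ) (hγ1 : γ < 1)
    (i : N) [Nonempty (A i)] (K : {j : N // j ≠ i} → ℕ)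
    (π : ∀ j : {j : N // j ≠ i}, StochasticGame.MemoryStrategy S A (K j) (j : N)) :
    ∃ σ : StochasticGame.MemoryStrategy S A (Finset.univ.sup K) i,
      G.IsBestResponse γ σ.toStrategy (fun j => (π j).toStrategy) := by
  refine G.exists_memory_bestResponse hγ0 hγ1 _ _ fun j h => ?_
  -- Since K j is at most the supremum, truncating first to the longer window leaves the last K j
  -- steps unchanged.
  exact congrArg (π j) (StochasticGame.recent_recent (Finset.le_sup (Finset.mem_univ j)) h)
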